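/- Let $\Gamma$ be a free group of finite rank $p\ge 2$ with a fixed free generating set $\mathcal A=\{a_1,\dots,a_p\}$, and for $x\in\Gamma$ let $|x|$ denote the length of the reduced word in $\mathcal A\cup\mathcal A^{-1}$ that represents $x$. Let $\Gamma$ act convex co-compactly on a $\mathrm{CAT}(-1)$ space $(X,d)$: the action is isometric and properly discontinuous, and the part in $X$ of the closed convex hull of the limit set of $\Gamma$ (the smallest closed convex subset of $X$ that contains all geodesic lines with both endpoints in the limit set) is non-empty and has compact quotient by $\Gamma$. Let $o\in X$, and put $\Gamma_n=\{x\in\Gamma : |x|=n\}$. Then there is a real number $\lambda>0$ such that $$\lim_{n\to\infty}\frac1{\#\Gamma_n}\sum_{x\in\Gamma_n}\frac{d(o,xo)}{n}=\lambda ,$$ and such that for every non-trivial conjugacy class $\mathfrak C$ of $\Gamma$, with $k=\min\{|x| : x\in\mathfrak C\}$ and $\mathfrak C_n=\{x\in\mathfrak C : |x|=n\}$, $$\lim_{m\to\infty}\frac1{\#\mathfrak C_{k+2m}}\sum_{x\in\mathfrak C_{k+2m}}\frac{d(o,xo)}{k+2m}=\lambda .$$ -/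

import Mathlib

open Filter Topology Set
open scoped NNReal

/-- `c`, restricted to `[0, dist x y]`, is a geodesic segment from `x` to `y`, parametrised by
arc length. -/
def IsGeodesicSegment {X : Type*} [MetricSpace X] (c : ℝ → X) (x y : X) : Prop :=
  c 0 = x ∧ c (dist x y) = y ∧
    ∀ s ∈ Icc (0 : ℝ) (dist x y), ∀ t ∈ Icc (0 : ℝ) (dist x y), dist (c s) (c t) = |s - t|

/-- `X` is a CAT(-1) space: a geodesic metric space all of whose geodesic triangles are at least
as thin as their comparison triangles in the hyperbolic plane (the upper half plane with the
metric of curvature `-1`).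

Two points on a geodesic triangle which are not on a common side lie on two sides that share a
vertex; below this vertex is `p`, the two sides are `a = [p, q]` and `b = [p, r]`, and the
comparison points of `a s` and `b t` are `a' s` and `b' t`.  Comparison triangles exist and are
unique up to isometries of the hyperbolic plane, so that it does not matter which one is used. -/
structure IsCATNegOne (X : Type*) [MetricSpace X] : Prop where
  exists_geodesic : ∀ x y : X, ∃ c : ℝ → X, IsGeodesicSegment c x y
  comparison : ∀ (p q r : X) (a b : ℝ → X), IsGeodesicSegment a p q → IsGeodesicSegment b p r →
    ∃ (p' q' r' : UpperHalfPlane) (a' b' : ℝ → UpperHalfPlane),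
      dist p' q' = dist p q ∧ dist p' r' = dist p r ∧ dist q' r' = dist q r ∧
      IsGeodesicSegment a' p' q' ∧ IsGeodesicSegment b' p' r' ∧
      ∀ s ∈ Icc (0 : ℝ) (dist p q), ∀ t ∈ Icc (0 : ℝ) (dist p r),
        dist (a s) (b t) ≤ dist (a' s) (b' t)

/-- Geodesic rays `[0, ∞) → X`, parametrised by arc length. -/
def GeodesicRay (X : Type*) [MetricSpace X] : Type _ := {r : ℝ≥0 → X // Isometry r}

/-- Two geodesic rays are asymptotic if they stay at bounded distance from each other. -/
def asymptoticSetoid (X : Type*) [MetricSpace X] : Setoid (GeodesicRay X) where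
  r a b := ∃ K : ℝ, ∀ t : ℝ≥0, dist (a.1 t) (b.1 t) ≤ K
  iseqv :=
    { refl := fun a => ⟨0, fun t => (dist_self (a.1 t)).le⟩
      symm := fun {a b} ⟨K, hK⟩ => ⟨K, fun t => (dist_comm (b.1 t) (a.1 t)).trans_le (hK t)⟩
      trans := fun {a b c} ⟨K, hK⟩ ⟨L, hL⟩ =>
        ⟨K + L, fun t => (dist_triangle (a.1 t) (b.1 t) (c.1 t)).trans
          (add_le_add (hK t) (hL t))⟩ }

/-- The boundary at infinity of `X`: asymptote classes of geodesic rays. -/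
def BoundaryAtInfinity (X : Type*) [MetricSpace X] : Type _ := Quotient (asymptoticSetoid X)

/-- The endpoint at infinity of a geodesic ray. -/
def GeodesicRay.endpoint {X : Type*} [MetricSpace X] (r : GeodesicRay X) : BoundaryAtInfinity X :=
  Quotient.mk (asymptoticSetoid X) r

/-- Convergence of a sequence `x` of points of `X` to a point `ξ` at infinity in the cone topology:
the points `x n` go off to infinity, and for a geodesic ray `r` ending at `ξ` the geodesic segments
from the origin of `r` to `x n` converge to `r`. -/
def TendstoBoundary {X : Type*} [MetricSpace X] (x : ℕ → X) (ξ : BoundaryAtInfinity X) : Prop :=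
  ∃ r : GeodesicRay X, r.endpoint = ξ ∧
    Tendsto (fun n => dist (r.1 0) (x n)) atTop atTop ∧
    ∃ c : ℕ → ℝ → X, (∀ n, IsGeodesicSegment (c n) (r.1 0) (x n)) ∧
      ∀ t : ℝ≥0, Tendsto (fun n => c n (t : ℝ)) atTop (𝓝 (r.1 t))

/-- The limit set of `Γ`: the points at infinity that are limits of sequences in an orbit of `Γ`
(all orbits have the same limits). -/
def limitSet (Γ X : Type*) [Group Γ] [MetricSpace X] [MulAction Γ X] :
    Set (BoundaryAtInfinity X) :=
  {ξ | ∃ (x : X) (g : ℕ → Γ), TendstoBoundary (fun n => g n • x) ξ}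

/-- `S` contains every geodesic segment between two of its points. -/
def IsGeodesicallyConvex {X : Type*} [MetricSpace X] (S : Set X) : Prop :=
  ∀ x ∈ S, ∀ y ∈ S, ∀ c : ℝ → X, IsGeodesicSegment c x y →
    ∀ t ∈ Icc (0 : ℝ) (dist x y), c t ∈ S

/-- The ray along which a geodesic line `c` runs towards `c (∞)`. -/
def forwardRay {X : Type*} [MetricSpace X] (c : ℝ → X) (hc : Isometry c) : GeodesicRay X :=
  ⟨fun t => c (t : ℝ), hc.comp isometry_subtype_coe⟩

/-- The ray along which a geodesic line `c` runs towards `c (-∞)`. -/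
def backwardRay {X : Type*} [MetricSpace X] (c : ℝ → X) (hc : Isometry c) : GeodesicRay X :=
  ⟨fun t => c (-(t : ℝ)), hc.comp ((IsometryEquiv.neg ℝ).isometry.comp isometry_subtype_coe)⟩

/-- The part in `X` of the convex hull of the limit set of `Γ`: the smallest closed convex subset
of `X` that contains every geodesic line with both endpoints in the limit set. -/
def limitSetHull (Γ X : Type*) [Group Γ] [MetricSpace X] [MulAction Γ X] : Set X :=
  ⋂₀ {S | IsClosed S ∧ IsGeodesicallyConvex S ∧
    ∀ (c : ℝ → X) (hc : Isometry c), (forwardRay c hc).endpoint ∈ limitSet Γ X →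
      (backwardRay c hc).endpoint ∈ limitSet Γ X → range c ⊆ S}

/-- The action of `Γ` on `X` is convex co-compact: it is isometric and properly discontinuous, and
the part in `X` of the convex hull of the limit set is non-empty with compact image in `X / Γ`. -/
structure IsConvexCocompact (Γ X : Type*) [Group Γ] [MetricSpace X] [MulAction Γ X] : Prop where
  isometric : IsIsometricSMul Γ X
  properlyDiscontinuous : ProperlyDiscontinuousSMul Γ X
  hull_nonempty : (limitSetHull Γ X).Nonempty
  compact_quotient : IsCompact (Quotient.mk (MulAction.orbitRel Γ X) '' limitSetHull Γ X)

/-- Word length with respect to a free generating set: the length of the reduced word. -/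
def wordLength {Γ : Type*} [Group Γ] {p : ℕ} (A : FreeGroupBasis (Fin p) Γ) (x : Γ) : ℕ :=
  (A.repr x).norm

/-- The average of `f` over a finite set `S`. -/
noncomputable def average {α : Type*} (S : Set α) (f : α → ℝ) : ℝ :=
  1 / (S.ncard : ℝ) * ∑ᶠ x ∈ S, f x

/-- The smallest word length of an element of a conjugacy class. -/
noncomputable def minLength {Γ : Type*} [Group Γ] {p : ℕ} (A : FreeGroupBasis (Fin p) Γ)
    (C : ConjClasses Γ) : ℕ :=
  sInf (wordLength A '' C.carrier)

/-! Write D(x) = d(o, xo). Two facts on D suffice: word length is at most C·D + C, and D(u) + D(v) ≤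
D(uv) + C whenever the product uv is reduced (`exists_displacement_bounds`). For both, join a hull
point o' to xo' by a geodesic. It stays in the hull, which has compact quotient, so its points are
shadowed by group elements with bounded jumps. Counting jumps gives the first fact. For the second,
a path with bounded jumps in the Cayley tree from 1 to uv must pass near u, so uo is near the
geodesic.

Next, average D over the words of length n that may follow a letter l. Up to a bounded error the
result f(n) does not depend on l: the followers of two letters differ in at most one of 2p - 1 ≥ 3
places, so a discrepancy does not grow with n (`abs_wordAverage_sub_wordAverage_le`). Hence f is
subadditive up to a constant, and Fekete's lemma gives f(n)/n → λ; linear growth of D makes λ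
positive.

An element of length m + 1 is bw with b a letter, and D(bw) = D(w) + O(1). An element of length k +
2(m + 1) of the conjugacy class is uniquely (bv)⁻¹w(bv) without cancellation, with w one of finitely
many cyclically reduced words, and D of it is 2D(v) + O(1). The numbers of words w, v for given
initial data agree, so the two averages are f(m)/(m + 1) and 2f(m)/(k + 2(m + 1)) up to O(1/m). -/

/-! ### Invariance and convexity of the hull. -/

section Hull

variable {Γ X : Type*} [Group Γ] [MetricSpace X] [MulAction Γ X]

theorem IsGeodesicSegment.smul [IsIsometricSMul Γ X] {c : ℝ → X} {x y : X}
    (h : IsGeodesicSegment c x y) (g : Γ) :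
    IsGeodesicSegment (fun t => g • c t) (g • x) (g • y) := by
  refine ⟨congrArg (g • ·) h.1, by rw [dist_smul]; exact congrArg (g • ·) h.2.1, ?_⟩
  simpa only [dist_smul] using h.2.2

/-- The image of a geodesic ray under an isometric action. -/
def GeodesicRay.translate [IsIsometricSMul Γ X] (g : Γ) (r : GeodesicRay X) : GeodesicRay X :=
  ⟨fun t => g • r.1 t, (isometry_smul X g).comp r.2⟩

theorem translate_endpoint_mem_limitSet [IsIsometricSMul Γ X] {r : GeodesicRay X}
    (hr : r.endpoint ∈ limitSet Γ X) (g : Γ) :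
    (r.translate g).endpoint ∈ limitSet Γ X := by
  obtain ⟨x, h, s, hs, hinf, c, hc, hlim⟩ := hr
  obtain ⟨K, hK⟩ := Quotient.exact hs
  refine ⟨x, fun n => g * h n, s.translate g,
    Quotient.sound ⟨K, fun t => (dist_smul g _ _).trans_le (hK t)⟩, ?_, fun n t => g • c n t, ?_, ?_⟩
  · simpa only [mul_smul, GeodesicRay.translate, dist_smul] using hinf
  · intro n
    change IsGeodesicSegment _ (g • s.1 0) ((g * h n) • x)
    rw [mul_smul]
    exact (hc n).smul g
  · intro t
    exact (hlim t).const_smul g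

/-- The family of closed convex sets that defines the hull is stable under preimages by `g`. -/
theorem smul_mem_limitSetHull [IsIsometricSMul Γ X] {x : X} (hx : x ∈ limitSetHull Γ X) (g : Γ) :
    g • x ∈ limitSetHull Γ X := by
  rintro S ⟨hcl, hconv, hlines⟩
  refine hx ((g • ·) ⁻¹' S) ⟨hcl.preimage (continuous_const_smul g), ?_, ?_⟩
  · intro y hy z hz c hc t ht
    exact hconv _ hy _ hz _ (hc.smul g) t (by rwa [dist_smul])
  · rintro c hc hf hb _ ⟨t, rfl⟩
    exact hlines (fun t => g • c t) ((isometry_smul X g).comp hc)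
      (translate_endpoint_mem_limitSet hf g) (translate_endpoint_mem_limitSet hb g) ⟨t, rfl⟩

theorem isGeodesicallyConvex_limitSetHull : IsGeodesicallyConvex (limitSetHull Γ X) :=
  fun x hx y hy c hc t ht S hS => hS.2.1 x (hx S hS) y (hy S hS) c hc t ht

end Hull

/-! ### From points of a cocompact set to group elements. -/

section CoarseProjection

variable {Γ X : Type*} [Group Γ] [MetricSpace X] [MulAction Γ X]

/-- Proper discontinuity concerns compact sets, and balls of `X` need not be relatively compact. But
if every ball failed, some `g n • y ≠ y` would converge to `y`; a convergent sequence with its limit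
is compact, so only finitely many `g n` occur and their displacements of `y` are bounded below. -/
theorem exists_pos_finite_dist_smul_lt [ProperlyDiscontinuousSMul Γ X] (y : X) :
    ∃ r > 0, {g : Γ | dist (g • y) y < r}.Finite := by
  by_contra! hcon
  have hstab : {g : Γ | g • y = y}.Finite := by
    refine (ProperlyDiscontinuousSMul.finite_disjoint_inter_image
      (isCompact_singleton (x := y)) (isCompact_singleton (x := y))).subset fun g hg => ?_
    exact ⟨y, ⟨y, rfl, hg⟩, rfl⟩
  have hne (n : ℕ) : ∃ g : Γ, dist (g • y) y < 1 / ((n : ℝ) + 1) ∧ g • y ≠ y := by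
    have hinf : {g : Γ | dist (g • y) y < 1 / ((n : ℝ) + 1)}.Infinite := hcon _ (by positivity)
    obtain ⟨g, hg, hg'⟩ := (hinf.sdiff hstab).nonempty
    exact ⟨g, hg, hg'⟩
  choose g hg hgy using hne
  have hlim : Tendsto (fun n => g n • y) atTop (𝓝 y) :=
    tendsto_iff_dist_tendsto_zero.2 <| squeeze_zero (fun _ => dist_nonneg) (fun n => (hg n).le)
      tendsto_one_div_add_atTop_nhds_zero_nat
  have hfin : (range g).Finite := by
    refine (ProperlyDiscontinuousSMul.finite_disjoint_inter_image
      (isCompact_singleton (x := y)) hlim.isCompact_insert_range).subset ?_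
    rintro _ ⟨n, rfl⟩
    exact ⟨g n • y, ⟨y, rfl, rfl⟩, Or.inr ⟨n, rfl⟩⟩
  obtain ⟨_, ⟨n, rfl⟩, hn⟩ := hfin.exists_minimalFor (fun h => dist (h • y) y) _ (range_nonempty g)
  have hpos : 0 < dist (g n • y) y := dist_pos.2 (hgy n)
  obtain ⟨m, hm⟩ := exists_nat_one_div_lt hpos
  have h1 := (hg m).trans hm
  exact absurd (hn (mem_range_self m) h1.le) (not_le.2 h1)

/-- If `a` and `g` both bring `z` within `r / 2` of `y`, then `a⁻¹ * g` moves `z` by less than `r`.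
-/
theorem finite_dist_smul_lt_half [IsIsometricSMul Γ X] {z : X} {r : ℝ}
    (h : {g : Γ | dist (g • z) z < r}.Finite) (y : X) :
    {g : Γ | dist y (g • z) < r / 2}.Finite := by
  rcases eq_empty_or_nonempty {g : Γ | dist y (g • z) < r / 2} with he | ⟨a, ha⟩
  · rw [he]; exact finite_empty
  · refine (h.preimage (f := fun g => a⁻¹ * g) (mul_right_injective a⁻¹).injOn).subset fun g hg => ?_
    simp only [mem_ofPred_eq, mem_preimage] at ha hg ⊢
    rw [← dist_smul a, smul_smul, mul_inv_cancel_left]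
    linarith [dist_triangle (g • z) y (a • z), dist_comm y (g • z)]

theorem finite_dist_smul_lt_half' [IsIsometricSMul Γ X] {y : X} {r : ℝ}
    (h : {g : Γ | dist (g • y) y < r}.Finite) (z : X) :
    {g : Γ | dist y (g • z) < r / 2}.Finite := by
  refine ((finite_dist_smul_lt_half h z).preimage inv_injective.injOn).subset fun g hg => ?_
  simp only [mem_ofPred_eq, mem_preimage] at hg ⊢
  rwa [← dist_smul g, smul_inv_smul, dist_comm]

theorem exists_finset_cover_of_isCompact_quotient [IsIsometricSMul Γ X] {H : Set X}
    (hH : IsCompact (Quotient.mk (MulAction.orbitRel Γ X) '' H)) {r : X → ℝ} (hr : ∀ x, 0 < r x) :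
    ∃ Y : Finset X, ∀ x ∈ H, ∃ y ∈ Y, ∃ g : Γ, dist x (g • y) < r y := by
  obtain ⟨Y, hY⟩ := hH.elim_finite_subcover
    (fun y : X => Quotient.mk (MulAction.orbitRel Γ X) '' Metric.ball y (r y))
    (fun y => isOpenMap_quotient_mk'_mul _ Metric.isOpen_ball)
    (by
      rintro _ ⟨x, -, rfl⟩
      exact mem_iUnion.2 ⟨x, x, Metric.mem_ball_self (hr x), rfl⟩)
  refine ⟨Y, fun x hx => ?_⟩
  obtain ⟨y, hy, z, hz, hzx⟩ := mem_iUnion₂.1 (hY ⟨x, hx, rfl⟩)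
  obtain ⟨g, rfl⟩ : ∃ g : Γ, g • x = z := MulAction.orbitRel_apply.1 (Quotient.exact hzx)
  refine ⟨y, hy, g⁻¹, ?_⟩
  rwa [← dist_smul g, smul_inv_smul]

/-- A subset with compact quotient projects coarsely to the group: nearby points are related to
group elements that differ by a bounded amount. -/
theorem exists_coarse_projection [IsIsometricSMul Γ X] [ProperlyDiscontinuousSMul Γ X] {H : Set X}
    (hH : IsCompact (Quotient.mk (MulAction.orbitRel Γ X) '' H)) (o o' : X) (len : Γ → ℕ) :
    ∃ (Rel : X → Γ → Prop) (ε : ℝ) (L : ℕ) (R : ℝ), 0 < ε ∧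
      (∀ x ∈ H, ∃ g, Rel x g) ∧ (∀ g : Γ, Rel (g • o') g) ∧
      (∀ x g, Rel x g → dist x (g • o) ≤ R) ∧
      ∀ x y g h, Rel x g → Rel y h → dist x y ≤ ε → len (g⁻¹ * h) ≤ L := by
  classical
  choose r hr hfin using exists_pos_finite_dist_smul_lt (Γ := Γ) (X := X)
  obtain ⟨Y₀, hY₀⟩ := exists_finset_cover_of_isCompact_quotient hH
    (r := fun x => r x / 6) (fun x => by linarith [hr x])
  set Y := insert o' Y₀ with hY
  have hYne : Y.Nonempty := Finset.insert_nonempty _ _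
  obtain ⟨y₁, -, hmin⟩ := Y.exists_min_image r hYne
  obtain ⟨y₂, -, hmax⟩ := Y.exists_max_image (fun y => r y / 6 + dist y o) hYne
  have hS : (⋃ y ∈ Y, ⋃ z ∈ Y, ({g : Γ | dist y (g • z) < r z / 2} ∪
      {g : Γ | dist y (g • z) < r y / 2})).Finite :=
    Y.finite_toSet.biUnion fun y _ => Y.finite_toSet.biUnion fun z _ =>
      (finite_dist_smul_lt_half (hfin z) y).union (finite_dist_smul_lt_half' (hfin y) z)
  obtain ⟨L, hL⟩ := (hS.image len).bddAbove
  -- `Rel x g` means that `x` is in the `g`-translate of a small ball about a point of the finite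
  -- net `Y`; `o'` was added to `Y` so that `g • o'` is related to `g` itself.
  refine ⟨fun x g => ∃ y ∈ Y, dist x (g • y) < r y / 6, r y₁ / 6, L, r y₂ / 6 + dist y₂ o,
    by linarith [hr y₁], ?_, ?_, ?_, ?_⟩
  · intro x hx
    obtain ⟨y, hy, g, hg⟩ := hY₀ x hx
    exact ⟨g, y, Finset.mem_insert_of_mem hy, hg⟩
  · exact fun g => ⟨o', Finset.mem_insert_self _ _, by rw [dist_self]; linarith [hr o']⟩
  · rintro x g ⟨y, hy, hxy⟩
    have := hmax y hy
    linarith [dist_triangle x (g • y) (g • o), dist_smul g y o]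
  · rintro x x' g h ⟨y, hy, hxy⟩ ⟨z, hz, hxz⟩ hd
    refine hL ⟨_, ?_, rfl⟩
    refine mem_iUnion₂.2 ⟨y, hy, mem_iUnion₂.2 ⟨z, hz, ?_⟩⟩
    have h1 : dist y ((g⁻¹ * h) • z) = dist (g • y) (h • z) := by
      rw [← dist_smul g, smul_smul, mul_inv_cancel_left]
    have h2 := dist_triangle4 (g • y) x x' (h • z)
    rw [dist_comm (g • y) x] at h2
    have h3 := hmin y hy
    have h4 := hmin z hz
    -- Each of the three distances is at most a sixth of the larger radius, so they sum to less than
    -- half of it.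
    rcases le_total (r y) (r z) with hle | hle
    · left
      simp only [mem_ofPred_eq, h1]
      linarith
    · right
      simp only [mem_ofPred_eq, h1]
      linarith

end CoarseProjection

/-! ### Separation in the Cayley tree. -/

section Tree

open FreeGroup

theorem FreeGroup.IsReduced.norm_mk {α : Type*} [DecidableEq α] {W : List (α × Bool)}
    (h : IsReduced W) : (FreeGroup.mk W).norm = W.length := by
  rw [norm, toWord_mk, h.reduce_eq]

theorem FreeGroup.IsReduced.invRev {α : Type*} {W : List (α × Bool)}
    (h : IsReduced W) : IsReduced (invRev W) := by
  classical
  rw [isReduced_iff_reduce_eq, reduce_invRev, h.reduce_eq]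

theorem FreeGroup.isReduced_append_iff {α : Type*} {U V : List (α × Bool)} :
    IsReduced (U ++ V) ↔ IsReduced U ∧ IsReduced V ∧
      ∀ a ∈ U.getLast?, ∀ b ∈ V.head?, a.1 = b.1 → a.2 = b.2 := List.isChain_append

/-- In the tree, a path from `G`, outside the branch at `U`, to `U ++ Z` has to traverse all of `Z`.
Common first letters of `G` and `U` are cancelled inductively; once the first letters differ,
nothing cancels. -/
theorem length_le_norm_of_not_prefix {α : Type*} [DecidableEq α] {U Z G : List (α × Bool)}
    (hG : IsReduced G) (hUZ : IsReduced (U ++ Z)) (h : ¬ U <+: G) :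
    Z.length ≤ (FreeGroup.mk (invRev G ++ (U ++ Z))).norm := by
  induction U generalizing G with
  | nil => exact absurd List.nil_prefix h
  | cons a U ih =>
    cases G with
    | nil =>
      rw [invRev_empty, List.nil_append, hUZ.norm_mk, List.length_append]
      omega
    | cons b G =>
      by_cases hab : a = b
      · subst hab
        have := ih (hG.infix ⟨[a], [], by simp⟩) (hUZ.infix ⟨[a], [], by simp⟩)
          (fun hp => h (List.cons_prefix_cons.2 ⟨rfl, hp⟩))
        refine this.trans (le_of_eq ?_)
        congr 1
        have hcons (W : List (α × Bool)) :
            FreeGroup.mk (a :: W) = FreeGroup.mk [a] * FreeGroup.mk W := by rw [mul_mk]; rfl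
        rw [← mul_mk, ← mul_mk (L₁ := invRev (a :: G)), ← inv_mk, ← inv_mk, List.cons_append,
          hcons G, hcons (U ++ Z)]
        group
      · have hr : IsReduced (invRev (b :: G) ++ ((a :: U) ++ Z)) := by
          refine isReduced_append_iff.2 ⟨hG.invRev, hUZ, ?_⟩
          have hl : (invRev (b :: G)).getLast? = some (b.1, !b.2) := by simp [invRev]
          rw [hl]
          simp only [Option.mem_def, Option.some.injEq, List.cons_append, List.head?_cons]
          rintro _ rfl _ rfl h1
          simp only at h1 ⊢
          have : a.2 ≠ b.2 := fun h2 => hab (Prod.ext h1.symm h2)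
          revert this
          cases a.2 <;> cases b.2 <;> simp
        rw [hr.norm_mk]
        simp only [List.length_append, List.length_cons]
        omega

/-- A coarse path in a free group from `1` to `u * v`, where `u * v` is a reduced product, passes
close to `u`. -/
theorem exists_norm_inv_mul_le_of_path {α : Type*} [DecidableEq α] {u v : FreeGroup α}
    (huv : (u * v).norm = u.norm + v.norm) {N L : ℕ} {γ : ℕ → FreeGroup α} (h0 : γ 0 = 1)
    (hN : γ N = u * v) (hstep : ∀ i < N, ((γ i)⁻¹ * γ (i + 1)).norm ≤ L) :
    ∃ i ≤ N, ((γ i)⁻¹ * u).norm ≤ L := by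
  have hword : (u * v).toWord = u.toWord ++ v.toWord :=
    (toWord_mul_sublist u v).eq_of_length (by rw [List.length_append]; exact huv)
  by_cases hu : u = 1
  · exact ⟨0, Nat.zero_le _, by simp [h0, hu]⟩
  -- Take the first time at which the path is in the branch at `u`. The jump that enters the branch
  -- is at least as long as the distance from its endpoint to `u`.
  have hex : ∃ i, u.toWord <+: (γ i).toWord := ⟨N, by rw [hN, hword]; exact List.prefix_append _ _⟩
  classical
  have hspec := Nat.find_spec hex
  have hle : Nat.find hex ≤ N :=
    Nat.find_min' hex (by rw [hN, hword]; exact List.prefix_append _ _)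
  have hlt := fun {m} => Nat.find_min hex (m := m)
  generalize Nat.find hex = i at hspec hle hlt
  cases i with
  | zero =>
    rw [h0, toWord_one, List.prefix_nil, toWord_eq_nil_iff] at hspec
    exact absurd hspec hu
  | succ i =>
    refine ⟨i + 1, hle, le_trans ?_ (hstep i hle)⟩
    obtain ⟨Z, hZ⟩ := hspec
    have hred : IsReduced (u.toWord ++ Z) := hZ ▸ isReduced_toWord
    have key := length_le_norm_of_not_prefix (isReduced_toWord (x := γ i)) hred
      (hlt (Nat.lt_succ_self i))
    rw [hZ, ← mul_mk, ← inv_mk, mk_toWord, mk_toWord] at key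
    refine le_trans ?_ key
    have h2 : γ (i + 1) = u * FreeGroup.mk Z := by
      rw [← mk_toWord (x := γ (i + 1)), ← hZ, ← mul_mk, mk_toWord]
    rw [← norm_inv_eq, mul_inv_rev, inv_inv, h2, inv_mul_cancel_left]
    exact norm_mk_le

end Tree

/-! ### Word length against displacement. -/

section OrbitMap

variable {Γ X : Type*} [Group Γ] [MetricSpace X] [MulAction Γ X]

theorem finite_setOf_norm_le {α : Type*} [DecidableEq α] [Finite α] (L : ℕ) :
    {x : FreeGroup α | x.norm ≤ L}.Finite :=
  (List.finite_length_le (α × Bool) L).preimage FreeGroup.toWord_injective.injOn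

theorem wordLength_mul_le {p : ℕ} (A : FreeGroupBasis (Fin p) Γ) (x y : Γ) :
    wordLength A (x * y) ≤ wordLength A x + wordLength A y := by
  rw [wordLength, map_mul]
  exact FreeGroup.norm_mul_le _ _

theorem dist_orbit_mul_le [IsIsometricSMul Γ X] (o : X) (g h : Γ) :
    dist o ((g * h) • o) ≤ dist o (g • o) + dist o (h • o) := by
  have := dist_triangle o (g • o) ((g * h) • o)
  rwa [mul_smul, dist_smul, ← mul_smul] at this

theorem dist_orbit_inv [IsIsometricSMul Γ X] (o : X) (g : Γ) :
    dist o (g⁻¹ • o) = dist o (g • o) := by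
  rw [← dist_smul g, smul_inv_smul, dist_comm]

/-- Geodesics in the convex hull between points of an orbit follow coarse paths in the group. -/
theorem exists_coarse_path (hX : IsCATNegOne X) (hΓ : IsConvexCocompact Γ X) (o : X)
    (len : Γ → ℕ) :
    ∃ (o' : X) (ε : ℝ) (L : ℕ) (R : ℝ), 0 < ε ∧ ∀ x : Γ,
      ∃ (N : ℕ) (γ : ℕ → Γ), N ≤ dist o' (x • o') / ε + 2 ∧ γ 0 = 1 ∧ γ N = x ∧
        (∀ i < N, len ((γ i)⁻¹ * γ (i + 1)) ≤ L) ∧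
        ∀ i, ∃ q, dist o' q + dist q (x • o') = dist o' (x • o') ∧ dist q (γ i • o) ≤ R := by
  have := hΓ.isometric
  have := hΓ.properlyDiscontinuous
  obtain ⟨o', ho'⟩ := hΓ.hull_nonempty
  obtain ⟨Rel, ε, L, R, hε, hproj, horb, hR, hL⟩ :=
    exists_coarse_projection hΓ.compact_quotient o o' len
  refine ⟨o', ε, L, R, hε, fun x => ?_⟩
  obtain ⟨c, hc⟩ := hX.exists_geodesic o' (x • o')
  set d := dist o' (x • o') with hd
  have hd0 : 0 ≤ d := dist_nonneg
  -- The summand 1 keeps `0` and `N` distinct, so that both end values of `γ` can be prescribed;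
  -- clamping the times at `d` makes the last point exactly `x • o'`.
  set N := ⌈d / ε⌉₊ + 1 with hN
  set t : ℕ → ℝ := fun i => min (i * ε) d with ht
  have htmem (i : ℕ) : t i ∈ Icc 0 d := ⟨le_min (by positivity) hd0, min_le_right _ _⟩
  have hNd : d ≤ N * ε := by
    rw [← div_le_iff₀ hε, hN]
    push_cast
    linarith [Nat.le_ceil (d / ε)]
  have hex (i : ℕ) : ∃ g, Rel (c (t i)) g ∧ (i = 0 → g = 1) ∧ (i = N → g = x) := by
    rcases eq_or_ne i 0 with rfl | h0
    · refine ⟨1, ?_, fun _ => rfl, fun h => absurd h (by omega)⟩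
      have : t 0 = 0 := by simp [ht, hd0]
      rw [this, hc.1]
      simpa using horb 1
    · by_cases hi : i = N
      · refine ⟨x, ?_, fun h => absurd h h0, fun _ => rfl⟩
        have : t i = d := by rw [hi]; exact min_eq_right hNd
        rw [this, hc.2.1]
        exact horb x
      · obtain ⟨g, hg⟩ := hproj (c (t i)) (isGeodesicallyConvex_limitSetHull _ ho' _
          (smul_mem_limitSetHull ho' x) c hc _ (htmem i))
        exact ⟨g, hg, fun h => absurd h h0, fun h => absurd h hi⟩
  choose γ hγ h0 hγN using hex
  refine ⟨N, γ, ?_, h0 0 rfl, hγN N rfl, fun i _ => hL _ _ _ _ (hγ i) (hγ (i + 1)) ?_, fun i =>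
    ⟨c (t i), ?_, hR _ _ (hγ i)⟩⟩
  · have := Nat.ceil_lt_add_one (div_nonneg hd0 hε.le)
    rw [hN]
    push_cast
    linarith
  · rw [hc.2.2 _ (htmem i) _ (htmem (i + 1))]
    refine (abs_min_sub_min_le_max _ _ _ _).trans (max_le ?_ ?_)
    · push_cast
      rw [abs_le]
      constructor <;> linarith
    · simpa using hε.le
  · have h1 := hc.2.2 0 ⟨le_rfl, hd0⟩ _ (htmem i)
    have h2 := hc.2.2 _ (htmem i) d ⟨hd0, le_rfl⟩
    rw [hc.1, zero_sub, abs_neg, abs_of_nonneg (htmem i).1] at h1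
    rw [hc.2.1, abs_sub_comm, abs_of_nonneg (sub_nonneg.2 (htmem i).2)] at h2
    rw [h1, h2]
    ring

/-- Word length is bounded linearly by displacement, and displacement is coarsely additive on
reduced products. -/
theorem exists_displacement_bounds {p : ℕ} (A : FreeGroupBasis (Fin p) Γ) (hX : IsCATNegOne X)
    (hΓ : IsConvexCocompact Γ X) (o : X) :
    ∃ C : ℝ, 0 ≤ C ∧ (∀ x : Γ, (wordLength A x : ℝ) ≤ C * dist o (x • o) + C) ∧
      ∀ u v : Γ, wordLength A (u * v) = wordLength A u + wordLength A v →
        dist o (u • o) + dist o (v • o) ≤ dist o ((u * v) • o) + C := by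
  have := hΓ.isometric
  obtain ⟨o', ε, L, R, hε, hpath⟩ := exists_coarse_path hX hΓ o (wordLength A)
  have hbase (x : Γ) : dist o' (x • o') ≤ dist o (x • o) + 2 * dist o o' := by
    linarith [dist_triangle4 o' o (x • o) (x • o'), dist_smul x o o', dist_comm o' o]
  have hbase' (x : Γ) (q : X) : dist o q + dist q (x • o) ≤
      dist o' q + dist q (x • o') + 2 * dist o o' := by
    linarith [dist_triangle o o' q, dist_triangle q (x • o') (x • o), dist_smul x o' o,
      dist_comm o' o]
  have hfin : {g : Γ | wordLength A g ≤ L}.Finite :=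
    (finite_setOf_norm_le L).preimage A.repr.injective.injOn
  obtain ⟨M, hM⟩ := (hfin.image (fun g => dist o (g • o))).bddAbove
  have hδ : 0 ≤ dist o o' := dist_nonneg
  -- Two changes of base point cost `2 * dist o o'` each; the detour from the geodesic point `q` via
  -- `γ i • o` to `u • o` costs `R + M` and is made twice.
  have hsum : ∀ u v : Γ, wordLength A (u * v) = wordLength A u + wordLength A v →
      dist o (u • o) + dist o (v • o) ≤ dist o ((u * v) • o) + (4 * dist o o' + 2 * (R + M)) := by
    intro u v huv
    obtain ⟨N, γ, -, h0, hN, hstep, hq⟩ := hpath (u * v)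
    obtain ⟨i, -, hi⟩ := exists_norm_inv_mul_le_of_path (u := A.repr u) (v := A.repr v)
      (by rw [← map_mul]; exact huv) (γ := fun i => A.repr (γ i)) (N := N) (L := L)
      (by simp [h0]) (by simp [hN])
      (fun i hi => by rw [← map_inv, ← map_mul]; exact hstep i hi)
    rw [← map_inv, ← map_mul] at hi
    have hiM : dist o (((γ i)⁻¹ * u) • o) ≤ M := hM ⟨_, hi, rfl⟩
    rw [← dist_smul (γ i), smul_smul, mul_inv_cancel_left] at hiM
    obtain ⟨q, hq, hqR⟩ := hq i
    have h1 := dist_triangle4 o q (γ i • o) (u • o)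
    have h2 := dist_triangle4 (u • o) (γ i • o) q ((u * v) • o)
    have h3 : dist o (v • o) = dist (u • o) ((u * v) • o) := by rw [mul_smul, dist_smul]
    linarith [hbase (u * v), hbase' (u * v) q, dist_comm (u • o) (γ i • o), dist_comm q (γ i • o)]
  have hlin (x : Γ) : (wordLength A x : ℝ) ≤
      L / ε * dist o (x • o) + L * (2 * dist o o' / ε + 2) := by
    obtain ⟨N, γ, hNle, h0, hN, hstep, -⟩ := hpath x
    have hind : ∀ i ≤ N, wordLength A (γ i) ≤ i * L := by
      intro i
      induction i with
      | zero => simp [h0, wordLength]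
      | succ i ih =>
        intro hi
        have h1 := wordLength_mul_le A (γ i) ((γ i)⁻¹ * γ (i + 1))
        rw [mul_inv_cancel_left] at h1
        have h2 := hstep i hi
        have h3 := ih (by omega)
        rw [Nat.succ_mul]
        omega
    have h1 := hind N le_rfl
    rw [hN] at h1
    have h2 : (wordLength A x : ℝ) ≤ N * L := by exact_mod_cast h1
    have h3 : (N : ℝ) ≤ (dist o (x • o) + 2 * dist o o') / ε + 2 :=
      hNle.trans (by gcongr; exact hbase x)
    calc (wordLength A x : ℝ) ≤ N * L := h2
      _ ≤ ((dist o (x • o) + 2 * dist o o') / ε + 2) * L := by gcongr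
      _ = _ := by ring
  set C₁ : ℝ := 4 * dist o o' + 2 * (R + M)
  set C₂ : ℝ := L / ε
  set C₃ : ℝ := L * (2 * dist o o' / ε + 2)
  refine ⟨|C₁| + |C₂| + |C₃|, by positivity, fun x => (hlin x).trans ?_,
    fun u v huv => (hsum u v huv).trans ?_⟩
  · gcongr
    · linarith [abs_nonneg C₁, le_abs_self C₂, abs_nonneg C₃]
    · linarith [abs_nonneg C₁, abs_nonneg C₂, le_abs_self C₃]
  · linarith [le_abs_self C₁, abs_nonneg C₂, abs_nonneg C₃]

end OrbitMap

/-! ### Averages over reduced continuations of a letter. -/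

section Words

open FreeGroup

variable {α : Type*}

theorem isReduced_cons_append {l : α × Bool} {u v : List (α × Bool)} (hu : IsReduced (l :: u))
    (hv : IsReduced (u.getLastD l :: v)) : IsReduced (l :: (u ++ v)) := by
  induction u generalizing l with
  | nil => exact hv
  | cons b u ih =>
    rw [isReduced_cons_cons] at hu
    rw [List.cons_append, isReduced_cons_cons]
    rw [List.getLastD_cons] at hv
    exact ⟨hu.1, ih hu.2 hv⟩

theorem two_mul_card_sub_one_pos [Fintype α] (l : α × Bool) : (0 : ℝ) < 2 * Fintype.card α - 1 := by
  have : 1 ≤ Fintype.card α := Fintype.card_pos_iff.2 ⟨l.1⟩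
  have : (1 : ℝ) ≤ Fintype.card α := by exact_mod_cast this
  linarith

variable [Fintype α] [DecidableEq α]

/-- The letters that may follow a given letter in a reduced word. -/
def followers (l : α × Bool) : Finset (α × Bool) := Finset.univ.erase (l.1, !l.2)

/-- The words of length `n` that may follow a given letter in a reduced word. -/
def continuations : ℕ → α × Bool → Finset (List (α × Bool))
  | 0, _ => {[]}
  | n + 1, l => (followers l).biUnion fun b => (continuations n b).image (List.cons b)

theorem mem_followers {l b : α × Bool} : b ∈ followers l ↔ (l.1 = b.1 → l.2 = b.2) := by
  obtain ⟨a, i⟩ := l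
  obtain ⟨c, j⟩ := b
  simp only [followers, Finset.mem_erase, Finset.mem_univ, and_true, ne_eq, Prod.mk.injEq, not_and]
  constructor
  · intro h hac
    have := h hac.symm
    revert this
    cases i <;> cases j <;> simp
  · intro h hac
    have := h hac.symm
    revert this
    cases i <;> cases j <;> simp

theorem mem_continuations {n : ℕ} {l : α × Bool} {w : List (α × Bool)} :
    w ∈ continuations n l ↔ IsReduced (l :: w) ∧ w.length = n := by
  induction n generalizing l w with
  | zero =>
    simp only [continuations, Finset.mem_singleton, List.length_eq_zero_iff]
    exact ⟨by rintro rfl; exact ⟨IsReduced.singleton, rfl⟩, fun h => h.2⟩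
  | succ n ih =>
    cases w with
    | nil => simp [continuations]
    | cons b w =>
      simp only [continuations, Finset.mem_biUnion, Finset.mem_image, List.cons.injEq, ih,
        isReduced_cons_cons, mem_followers, List.length_cons, Nat.add_right_cancel_iff]
      constructor
      · rintro ⟨_, h, _, hw, rfl, rfl⟩
        exact ⟨⟨h, hw.1⟩, hw.2⟩
      · rintro ⟨⟨h, hw⟩, hl⟩
        exact ⟨b, h, w, ⟨hw, hl⟩, rfl, rfl⟩

theorem sum_continuations_succ (n : ℕ) (l : α × Bool) (G : List (α × Bool) → ℝ) :
    ∑ w ∈ continuations (n + 1) l, G w =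
      ∑ b ∈ followers l, ∑ w ∈ continuations n b, G (b :: w) := by
  rw [continuations, Finset.sum_biUnion]
  · exact Finset.sum_congr rfl fun b _ => Finset.sum_image fun _ _ _ _ h => (List.cons.inj h).2
  · intro b _ c _ hbc
    refine Finset.disjoint_left.2 fun w hb hc => hbc ?_
    obtain ⟨_, _, rfl⟩ := Finset.mem_image.1 hb
    obtain ⟨_, _, h⟩ := Finset.mem_image.1 hc
    exact (List.cons.inj h).1.symm

/-- The average of `G` over the words of length `n` that may follow the letter `l`. -/
noncomputable def wordAverage (n : ℕ) (l : α × Bool) (G : List (α × Bool) → ℝ) : ℝ :=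
  (∑ w ∈ continuations n l, G w) / (2 * Fintype.card α - 1 : ℝ) ^ n

theorem card_followers (l : α × Bool) :
    ((followers l).card : ℝ) = 2 * Fintype.card α - 1 := by
  have h1 : 0 < Fintype.card (α × Bool) := Fintype.card_pos_iff.2 ⟨l⟩
  rw [followers, Finset.card_erase_of_mem (Finset.mem_univ _), Finset.card_univ, Nat.cast_sub h1,
    Fintype.card_prod, Fintype.card_bool]
  push_cast
  ring

theorem wordAverage_zero (l : α × Bool) (G : List (α × Bool) → ℝ) : wordAverage 0 l G = G [] := by
  simp [wordAverage, continuations]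

theorem wordAverage_succ (n : ℕ) (l : α × Bool) (G : List (α × Bool) → ℝ) :
    wordAverage (n + 1) l G =
      (∑ b ∈ followers l, wordAverage n b fun w => G (b :: w)) / (2 * Fintype.card α - 1 : ℝ) := by
  simp only [wordAverage, sum_continuations_succ, ← Finset.sum_div, div_div, pow_succ]

/-- The count is independent of the letter, which makes `wordAverage` a genuine mean. -/
theorem card_continuations (n : ℕ) (l : α × Bool) :
    ((continuations n l).card : ℝ) = (2 * Fintype.card α - 1 : ℝ) ^ n := by
  induction n generalizing l with
  | zero => simp [continuations]
  | succ n ih =>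
    have := sum_continuations_succ n l (fun _ => (1 : ℝ))
    simp only [Finset.sum_const, nsmul_eq_mul, mul_one, ih, card_followers] at this
    rw [this, pow_succ']

theorem sum_continuations_eq (n : ℕ) (l : α × Bool) (G : List (α × Bool) → ℝ) :
    ∑ w ∈ continuations n l, G w = (2 * Fintype.card α - 1 : ℝ) ^ n * wordAverage n l G := by
  rw [wordAverage, mul_div_cancel₀]
  exact (pow_pos (two_mul_card_sub_one_pos l) n).ne'

theorem wordAverage_add (n : ℕ) (l : α × Bool) (G H : List (α × Bool) → ℝ) :
    wordAverage n l (fun w => G w + H w) = wordAverage n l G + wordAverage n l H := by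
  simp only [wordAverage, Finset.sum_add_distrib, add_div]

theorem wordAverage_const_mul (n : ℕ) (l : α × Bool) (a : ℝ) (G : List (α × Bool) → ℝ) :
    wordAverage n l (fun w => a * G w) = a * wordAverage n l G := by
  simp only [wordAverage, ← Finset.mul_sum, mul_div_assoc]

theorem wordAverage_const (n : ℕ) (l : α × Bool) (a : ℝ) :
    wordAverage n l (fun _ => a) = a := by
  rw [wordAverage, Finset.sum_const, nsmul_eq_mul, card_continuations, mul_div_cancel_left₀]
  exact (pow_pos (two_mul_card_sub_one_pos l) n).ne'

theorem wordAverage_mono {n : ℕ} {l : α × Bool} {G H : List (α × Bool) → ℝ}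
    (h : ∀ w ∈ continuations n l, G w ≤ H w) : wordAverage n l G ≤ wordAverage n l H := by
  have := pow_pos (two_mul_card_sub_one_pos l) n
  unfold wordAverage
  gcongr with w hw
  exact h w hw

theorem abs_wordAverage_sub_le {n : ℕ} {l : α × Bool} {G H : List (α × Bool) → ℝ} {K : ℝ}
    (h : ∀ w ∈ continuations n l, |G w - H w| ≤ K) :
    |wordAverage n l G - wordAverage n l H| ≤ K := by
  rw [abs_le]
  constructor
  · have := wordAverage_mono (n := n) (l := l) (G := H) (H := fun w => G w + K)
      fun w hw => by linarith [(abs_le.1 (h w hw)).1]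
    rw [wordAverage_add, wordAverage_const] at this
    linarith
  · have := wordAverage_mono (n := n) (l := l) (G := G) (H := fun w => H w + K)
      fun w hw => by linarith [(abs_le.1 (h w hw)).2]
    rw [wordAverage_add, wordAverage_const] at this
    linarith

/-- Markov property: what may follow `u` depends only on its last letter, or on `l` if `u` is empty.
-/
theorem wordAverage_append (n m : ℕ) (l : α × Bool) (G : List (α × Bool) → ℝ) :
    wordAverage (n + m) l G =
      wordAverage n l fun u => wordAverage m (u.getLastD l) fun v => G (u ++ v) := by
  induction n generalizing l G with
  | zero => simp [wordAverage_zero]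
  | succ n ih =>
    rw [Nat.add_right_comm, wordAverage_succ, wordAverage_succ]
    simp only [ih, List.getLastD_cons, List.cons_append]

end Words

/-! ### Linear growth of averages. -/

section Growth

open FreeGroup

variable {α : Type*} [Fintype α] [DecidableEq α]

/-- Both follower sums are the sum over all letters minus one term, so the full sums cancel.
Comparing the two omitted terms costs `2 * M` for dropping their first letters and `M` by induction;
dividing `3 * M` by 2p - 1 ≥ 3 restores the bound `M`. -/
theorem abs_wordAverage_sub_wordAverage_le {D : FreeGroup α → ℝ} (hα : 2 ≤ Fintype.card α) {M : ℝ} (hM0 : 0 ≤ M)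
    (hM : ∀ (b : α × Bool) (w : List (α × Bool)), |D (FreeGroup.mk (b :: w)) - D (FreeGroup.mk w)| ≤ M)
    (n : ℕ) (l l' : α × Bool) :
    |wordAverage n l (fun w => D (FreeGroup.mk w)) - wordAverage n l' (fun w => D (FreeGroup.mk w))| ≤ M := by
  induction n generalizing l l' with
  | zero => simpa [wordAverage_zero] using hM0
  | succ n ih =>
    have hs : (3 : ℝ) ≤ 2 * Fintype.card α - 1 := by
      have : (2 : ℝ) ≤ Fintype.card α := by exact_mod_cast hα
      linarith
    have hsum (l : α × Bool) : ∑ b ∈ followers l, (wordAverage n b fun w => D (FreeGroup.mk (b :: w))) =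
        ∑ b, (wordAverage n b fun w => D (FreeGroup.mk (b :: w))) -
          wordAverage n (l.1, !l.2) fun w => D (FreeGroup.mk ((l.1, !l.2) :: w)) :=
      Finset.sum_erase_eq_sub (Finset.mem_univ _)
    have hb (b : α × Bool) : |(wordAverage n b fun w => D (FreeGroup.mk (b :: w))) -
        wordAverage n b fun w => D (FreeGroup.mk w)| ≤ M := abs_wordAverage_sub_le fun w _ => hM b w
    rw [wordAverage_succ, wordAverage_succ, ← sub_div, hsum, hsum, abs_div,
      abs_of_pos (by linarith : (0 : ℝ) < 2 * Fintype.card α - 1), div_le_iff₀ (by linarith)]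
    have h1 := abs_le.1 (hb (l.1, !l.2))
    have h2 := abs_le.1 (hb (l'.1, !l'.2))
    have h3 := abs_le.1 (ih (l.1, !l.2) (l'.1, !l'.2))
    have h4 : M * 3 ≤ M * (2 * Fintype.card α - 1) := by gcongr
    rw [abs_le]
    constructor <;> linarith [h1.1, h1.2, h2.1, h2.2, h3.1, h3.2]

/-- A length function on a free group that is comparable to word length and coarsely additive on
reduced products. -/
structure IsCoarseLength (D : FreeGroup α → ℝ) (C : ℝ) : Prop where
  nonneg : ∀ x, 0 ≤ D x
  inv : ∀ x, D x⁻¹ = D x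
  mul_le : ∀ x y, D (x * y) ≤ D x + D y
  add_le : ∀ x y, (x * y).norm = x.norm + y.norm → D x + D y ≤ D (x * y) + C
  norm_le : ∀ x, (x.norm : ℝ) ≤ C * D x + C
  const_nonneg : 0 ≤ C

namespace IsCoarseLength

variable {D : FreeGroup α → ℝ} {C : ℝ} (hD : IsCoarseLength D C)
include hD

omit [Fintype α] in
theorem abs_mul_sub_le (x y : FreeGroup α) : |D (x * y) - D y| ≤ D x := by
  have h1 := hD.mul_le x⁻¹ (x * y)
  rw [inv_mul_cancel_left, hD.inv] at h1
  exact abs_le.2 ⟨by linarith, by linarith [hD.mul_le x y]⟩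

theorem exists_letter_bound : ∃ M, 0 ≤ M ∧
    ∀ (b : α × Bool) (w : List (α × Bool)), |D (FreeGroup.mk (b :: w)) - D (FreeGroup.mk w)| ≤ M := by
  refine ⟨∑ b : α × Bool, D (FreeGroup.mk [b]), Finset.sum_nonneg fun _ _ => hD.nonneg _, fun b w => ?_⟩
  rw [← List.singleton_append, ← mul_mk]
  exact (hD.abs_mul_sub_le _ _).trans
    (Finset.single_le_sum (f := fun b => D (FreeGroup.mk [b])) (fun _ _ => hD.nonneg _) (Finset.mem_univ b))

omit [Fintype α] in
theorem abs_append_sub_le {u v : List (α × Bool)} (h : IsReduced (u ++ v)) :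
    |D (FreeGroup.mk (u ++ v)) - (D (FreeGroup.mk u) + D (FreeGroup.mk v))| ≤ C := by
  have hu : IsReduced u := h.infix ⟨[], v, by simp⟩
  have hv : IsReduced v := h.infix ⟨u, [], by simp⟩
  rw [← mul_mk]
  have h1 := hD.add_le (FreeGroup.mk u) (FreeGroup.mk v)
    (by rw [mul_mk, h.norm_mk, hu.norm_mk, hv.norm_mk, List.length_append])
  have h2 := hD.mul_le (FreeGroup.mk u) (FreeGroup.mk v)
  exact abs_le.2 ⟨by linarith, by linarith [hD.const_nonneg]⟩

/-- The averages of a coarse length function over words that follow a given letter grow linearly,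
at a rate that does not depend on the letter. -/
theorem exists_growth (hα : 2 ≤ Fintype.card α) :
    ∃ (lam : ℝ) (f : ℕ → ℝ) (K : ℝ), 0 < lam ∧ Tendsto (fun n => f n / n) atTop (𝓝 lam) ∧
      0 ≤ K ∧ ∀ n (l : α × Bool), |wordAverage n l (fun w => D (FreeGroup.mk w)) - f n| ≤ K := by
  obtain ⟨M, hM0, hM⟩ := hD.exists_letter_bound
  have hosc := abs_wordAverage_sub_wordAverage_le hα hM0 hM
  obtain ⟨a⟩ : Nonempty α := Fintype.card_pos_iff.1 (by omega)
  set l : α × Bool := (a, true)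
  set f : ℕ → ℝ := fun n => wordAverage n l fun w => D (FreeGroup.mk w) with hf
  -- Splitting a word after `n` letters costs `C`; replacing the last letter of the first piece by
  -- `l` costs `M`.
  have hadd (n m : ℕ) : f (n + m) ≤ f n + f m + (C + M) := by
    have h1 : ∀ u ∈ continuations n l,
        (wordAverage m (u.getLastD l) fun v => D (FreeGroup.mk (u ++ v))) ≤ D (FreeGroup.mk u) + (f m + (C + M)) := by
      intro u hu
      have h2 := wordAverage_mono (n := m) (l := u.getLastD l) (G := fun v => D (FreeGroup.mk (u ++ v)))
        (H := fun v => D (FreeGroup.mk u) + C + D (FreeGroup.mk v)) fun v hv => by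
          have hred := isReduced_cons_append (mem_continuations.1 hu).1 (mem_continuations.1 hv).1
          have hred' : IsReduced (u ++ v) := hred.infix ⟨[l], [], by simp⟩
          have := (abs_le.1 (hD.abs_append_sub_le hred')).2
          linarith
      rw [wordAverage_add, wordAverage_const] at h2
      have h3 := (abs_le.1 (hosc m (u.getLastD l) l)).2
      simp only [hf]
      linarith
    have h4 := wordAverage_mono h1
    rw [← wordAverage_append n m l fun w => D (FreeGroup.mk w), wordAverage_add, wordAverage_const] at h4
    simp only [hf] at h4 ⊢
    linarith
  have hC := hD.const_nonneg
  -- The denominator is `C + 1` because `C` may vanish.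
  have hlow (n : ℕ) : ((n : ℝ) - C) / (C + 1) ≤ f n := by
    rw [← wordAverage_const n l (((n : ℝ) - C) / (C + 1))]
    refine wordAverage_mono fun w hw => ?_
    rw [div_le_iff₀ (by linarith)]
    obtain ⟨h1, h2⟩ := mem_continuations.1 hw
    have h3 := hD.norm_le (FreeGroup.mk w)
    have h4 : IsReduced w := h1.infix ⟨[l], [], by simp⟩
    rw [h4.norm_mk, h2] at h3
    nlinarith [hD.nonneg (FreeGroup.mk w)]
  have hsub : Subadditive fun n => f n + (C + M) := fun n m => by linarith [hadd n m]
  have hbdd : BddBelow (range fun n : ℕ => (f n + (C + M)) / n) := by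
    refine ⟨0, ?_⟩
    rintro _ ⟨n, rfl⟩
    have : 0 ≤ f n := by
      rw [← wordAverage_const n l 0]
      exact wordAverage_mono fun w _ => hD.nonneg _
    positivity
  have hzero (c : ℝ) : Tendsto (fun n : ℕ => c / n) atTop (𝓝 0) :=
    tendsto_const_div_atTop_nhds_zero_nat c
  have hlim : Tendsto (fun n : ℕ => f n / n) atTop (𝓝 hsub.lim) := by
    have := (hsub.tendsto_lim hbdd).sub (hzero (C + M))
    rw [sub_zero] at this
    refine this.congr fun n => ?_
    rw [← sub_div, add_sub_cancel_right]
  refine ⟨hsub.lim, f, M, ?_, hlim, hM0, fun n l' => hosc n l' l⟩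
  have h0 : Tendsto (fun n : ℕ => 1 / (C + 1) - C / (C + 1) / n) atTop (𝓝 (1 / (C + 1))) := by
    simpa using tendsto_const_nhds.sub (hzero (C / (C + 1)))
  refine (by positivity : 0 < 1 / (C + 1)).trans_le (le_of_tendsto_of_tendsto h0 hlim ?_)
  filter_upwards [eventually_gt_atTop 0] with n hn
  have hn' : (0 : ℝ) < n := by exact_mod_cast hn
  calc 1 / (C + 1) - C / (C + 1) / n = ((n : ℝ) - C) / (C + 1) / n := by field_simp
    _ ≤ f n / n := by gcongr; exact hlow n

end IsCoarseLength

/-- Averages over a set that is parametrised by continuations of letters. -/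
theorem abs_average_sub_le {ι β : Type*} [DecidableEq β] {I : Finset ι} (hI : I.Nonempty)
    {l : ι → α × Bool}
    {φ : ι → List (α × Bool) → β} {m : ℕ} {S : Set β} {F : List (α × Bool) → ℝ}
    (hS : ∀ x, x ∈ S ↔ ∃ i ∈ I, ∃ w ∈ continuations m (l i), φ i w = x)
    (hφ : ∀ i ∈ I, ∀ w ∈ continuations m (l i), ∀ j ∈ I, ∀ v ∈ continuations m (l j),
      φ i w = φ j v → i = j ∧ w = v)
    {G : β → ℝ} {a c f K K' : ℝ} (ha : 0 ≤ a)
    (hG : ∀ i ∈ I, ∀ w ∈ continuations m (l i), |G (φ i w) - a * F w| ≤ K')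
    (hF : ∀ i ∈ I, |wordAverage m (l i) F - f| ≤ K) (hc : K' + a * K ≤ c) :
    |average S G - a * f| ≤ c := by
  classical
  set T : Finset (Σ _ : ι, List (α × Bool)) := I.sigma fun i => continuations m (l i)
  have hinj : Set.InjOn (fun t : Σ _ : ι, List (α × Bool) => φ t.1 t.2) T := by
    rintro ⟨i, w⟩ hi ⟨j, v⟩ hj h
    obtain ⟨hi, hw⟩ := Finset.mem_sigma.1 hi
    obtain ⟨hj, hv⟩ := Finset.mem_sigma.1 hj
    obtain ⟨rfl, rfl⟩ := hφ i hi w hw j hj v hv h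
    rfl
  have hST : S = ((T.image fun t => φ t.1 t.2 : Finset β) : Set β) := by
    ext x
    rw [hS]
    simp only [Finset.coe_image, mem_image, Finset.mem_coe, T, Finset.mem_sigma, Sigma.exists]
    exact ⟨fun ⟨i, hi, w, hw, h⟩ => ⟨i, w, ⟨hi, hw⟩, h⟩, fun ⟨i, w, ⟨hi, hw⟩, h⟩ =>
      ⟨i, hi, w, hw, h⟩⟩
  obtain ⟨i₀, hi₀⟩ := hI
  have hs := pow_pos (two_mul_card_sub_one_pos (l i₀)) m
  have hIpos : (0 : ℝ) < I.card := by exact_mod_cast Finset.card_pos.2 ⟨i₀, hi₀⟩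
  have hcard : (T.card : ℝ) = I.card * (2 * Fintype.card α - 1 : ℝ) ^ m := by
    rw [Finset.card_sigma, Nat.cast_sum]
    simp [card_continuations]
  -- The fibres over `I` are equally large, so the average over `S` is the unweighted mean of the
  -- fibre averages.
  have havg : average S G =
      (∑ i ∈ I, wordAverage m (l i) fun w => G (φ i w)) / I.card := by
    rw [average, hST, finsum_mem_coe_finset, Set.ncard_coe_finset, Finset.card_image_of_injOn hinj,
      Finset.sum_image hinj, Finset.sum_sigma, hcard]
    simp only [sum_continuations_eq, ← Finset.mul_sum]
    field_simp
  have hterm : ∀ i ∈ I, |(wordAverage m (l i) fun w => G (φ i w)) - a * f| ≤ c := by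
    intro i hi
    have h1 := abs_wordAverage_sub_le (hG i hi)
    rw [wordAverage_const_mul] at h1
    have h2 : |a * wordAverage m (l i) F - a * f| ≤ a * K := by
      rw [← mul_sub, abs_mul, abs_of_nonneg ha]
      exact mul_le_mul_of_nonneg_left (hF i hi) ha
    exact (abs_sub_le _ _ _).trans ((add_le_add h1 h2).trans hc)
  rw [havg, ← mul_div_cancel_left₀ (a * f) hIpos.ne', ← sub_div, abs_div, abs_of_pos hIpos,
    div_le_iff₀ hIpos, ← nsmul_eq_mul, ← Finset.sum_const, ← Finset.sum_sub_distrib, mul_comm c,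
    ← nsmul_eq_mul]
  exact (Finset.abs_sum_le_sum_abs _ _).trans (Finset.sum_le_card_nsmul _ _ _ hterm)

end Growth

/-! ### Cyclically reduced words and conjugation without cancellation. -/

section CyclicWords

open FreeGroup

variable {α : Type*} [DecidableEq α]

theorem norm_pow_mk_of_isCyclicallyReduced {w : List (α × Bool)} (hw : IsCyclicallyReduced w)
    (n : ℕ) : (FreeGroup.mk w ^ n).norm = n * w.length := by
  rw [FreeGroup.norm, toWord_pow, toWord_mk, hw.isReduced.reduce_eq,
    (hw.flatten_replicate n).isReduced.reduce_eq]
  simp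

theorem FreeGroup.norm_pow_le (x : FreeGroup α) (n : ℕ) : (x ^ n).norm ≤ n * x.norm := by
  induction n with
  | zero => simp
  | succ n ih =>
    rw [pow_succ, Nat.succ_mul]
    exact (norm_mul_le _ _).trans (by gcongr)

/-- Cyclically reduced words have minimal length in their conjugacy class. -/
theorem length_le_norm_of_isConj {w : List (α × Bool)} (hw : IsCyclicallyReduced w)
    {x : FreeGroup α} (h : IsConj x (FreeGroup.mk w)) : w.length ≤ x.norm := by
  obtain ⟨g, hg⟩ := isConj_iff.1 h
  by_contra! hlt
  -- Conjugation by `g` adds at most `2 * g.norm` to the length of `x ^ n`, while `w ^ n` would be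
  -- longer than `n * x.norm` by at least `n`.
  set n := 2 * g.norm + 1 with hn
  have h1 := norm_pow_mk_of_isCyclicallyReduced hw n
  rw [← hg, conj_pow] at h1
  have h2 := norm_mul_le (g * x ^ n) g⁻¹
  have h3 := norm_mul_le g (x ^ n)
  have h4 := FreeGroup.norm_pow_le x n
  rw [norm_inv_eq] at h2
  have h5 : n * (x.norm + 1) ≤ n * w.length := Nat.mul_le_mul_left _ hlt
  rw [Nat.mul_succ] at h5
  omega

omit [DecidableEq α] in
-- Reducedness concerns adjacent letters only, so the three overlapping reduced words v⁻¹b⁻¹, b⁻¹wb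
-- and bv can be glued.
theorem isReduced_conj_append {b : α × Bool} {v w : List (α × Bool)} (hv : IsReduced (b :: v))
    (hw : IsReduced ((b.1, !b.2) :: w ++ [b])) :
    IsReduced (invRev (b :: v) ++ (w ++ (b :: v))) := by
  have h1 : IsReduced (invRev (b :: v)) := hv.invRev
  have h2 : invRev (b :: v) = invRev v ++ [(b.1, !b.2)] := by simp [invRev]
  rw [h2] at h1 ⊢
  have h3 : IsReduced (invRev v ++ [(b.1, !b.2)] ++ (w ++ [b])) :=
    h1.append_overlap (by simpa using hw) (by simp)
  have h4 : IsReduced ((invRev v ++ [(b.1, !b.2)] ++ w) ++ [b] ++ v) :=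
    IsReduced.append_overlap (by simpa using h3) (by simpa using hv) (by simp)
  simpa using h4

/-- Only the first letter of `w` and the inverse of its last letter are forbidden, and there are at
least four letters. -/
theorem exists_letter_conj_isReduced [Fintype α] (hα : 2 ≤ Fintype.card α) {w : List (α × Bool)}
    (hw : IsReduced w) (hne : w ≠ []) :
    ∃ b : α × Bool, IsReduced ((b.1, !b.2) :: w ++ [b]) := by
  obtain ⟨b, hb⟩ : ∃ b, b ∉ ({w.head hne, ((w.getLast hne).1, !(w.getLast hne).2)} :
      Finset (α × Bool)) := by
    by_contra! h
    have h1 := Finset.card_le_card (fun b _ => h b : Finset.univ ⊆ _)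
    rw [Finset.card_univ, Fintype.card_prod, Fintype.card_bool] at h1
    have := h1.trans Finset.card_le_two
    omega
  simp only [Finset.mem_insert, Finset.mem_singleton, not_or] at hb
  refine ⟨b, ?_⟩
  have h1 : IsReduced (w ++ [b]) := by
    refine isReduced_append_iff.2 ⟨hw, IsReduced.singleton, ?_⟩
    rw [List.getLast?_eq_some_getLast hne]
    simp only [Option.mem_def, Option.some.injEq, List.head?_cons]
    rintro _ rfl _ rfl h
    by_contra h'
    refine hb.2 (Prod.ext h.symm ?_)
    revert h'
    cases (w.getLast hne).2 <;> cases b.2 <;> simp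
  have h2 : IsReduced ([(b.1, !b.2)] ++ (w ++ [b])) := by
    refine isReduced_append_iff.2 ⟨IsReduced.singleton, h1, ?_⟩
    rw [List.head?_append_of_ne_nil _ hne, List.head?_eq_some_head hne]
    simp only [Option.mem_def, Option.some.injEq, List.getLast?_singleton]
    rintro _ rfl _ rfl h
    by_contra h'
    refine hb.1 (Prod.ext h ?_)
    simp only at h'
    revert h'
    cases (w.head hne).2 <;> cases b.2 <;> simp
  simpa using h2

/-- Conjugation at least doubles the displacement of the conjugating word, up to a constant, if
there is no cancellation. -/
theorem IsCoarseLength.abs_conj_sub_le {D : FreeGroup α → ℝ} {C : ℝ} (hD : IsCoarseLength D C)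
    {y w : List (α × Bool)} (h : IsReduced (invRev y ++ (w ++ y))) :
    |D (FreeGroup.mk (invRev y ++ (w ++ y))) - 2 * D (FreeGroup.mk y)| ≤
      D (FreeGroup.mk w) + C := by
  have h1 := abs_le.1 (hD.abs_append_sub_le h)
  have h2 := abs_le.1 (hD.abs_mul_sub_le (FreeGroup.mk w) (FreeGroup.mk y))
  rw [← mul_mk (L₁ := invRev y), ← mul_mk (L₁ := w), ← inv_mk, hD.inv (FreeGroup.mk y)] at h1
  rw [← mul_mk, ← mul_mk (L₁ := w), ← inv_mk, abs_le]
  constructor <;> linarith [h1.1, h1.2, h2.1, h2.2]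

end CyclicWords

/-! ### Normal form of the elements of a conjugacy class. -/

section ConjClasses

open FreeGroup

variable {Γ : Type*} [Group Γ] {p : ℕ} (A : FreeGroupBasis (Fin p) Γ) (C : ConjClasses Γ)

/-- The cyclically reduced words that represent elements of a conjugacy class. -/
def cyclicWords : Set (List (Fin p × Bool)) :=
  {w | IsCyclicallyReduced w ∧ A.repr.symm (FreeGroup.mk w) ∈ C.carrier}

variable {A C}

theorem isConj_repr {x y : Γ} (hx : x ∈ C.carrier) (hy : y ∈ C.carrier) :
    IsConj (A.repr x) (A.repr y) := by
  rw [ConjClasses.mem_carrier_iff_mk_eq] at hx hy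
  exact A.repr.toMonoidHom.map_isConj (ConjClasses.mk_eq_mk_iff_isConj.1 (hx.trans hy.symm))

theorem length_of_mem_cyclicWords {w : List (Fin p × Bool)} (hw : w ∈ cyclicWords A C) :
    w.length = minLength A C := by
  refine le_antisymm ?_ ?_
  · refine le_csInf ⟨_, mem_image_of_mem _ hw.2⟩ ?_
    rintro _ ⟨x, hx, rfl⟩
    refine length_le_norm_of_isConj hw.1 ?_
    simpa using isConj_repr (A := A) hx hw.2
  · refine Nat.sInf_le ⟨_, hw.2, ?_⟩
    rw [wordLength, MulEquiv.apply_symm_apply, hw.1.isReduced.norm_mk]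

theorem reduceCyclically_mem_cyclicWords {x : Γ} (hx : x ∈ C.carrier) :
    reduceCyclically (A.repr x).toWord ∈ cyclicWords A C := by
  refine ⟨reduceCyclically.isCyclicallyReduced isReduced_toWord, ?_⟩
  have h := congrArg FreeGroup.mk
    (reduceCyclically.conj_conjugator_reduceCyclically (A.repr x).toWord)
  rw [← mul_mk, ← mul_mk, ← inv_mk, mk_toWord] at h
  rw [ConjClasses.mem_carrier_iff_mk_eq] at hx ⊢
  rw [← hx, ConjClasses.mk_eq_mk_iff_isConj, isConj_iff]
  refine ⟨A.repr.symm (FreeGroup.mk (reduceCyclically.conjugator (A.repr x).toWord)), ?_⟩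
  rw [← _root_.map_inv, ← _root_.map_mul, ← _root_.map_mul, h, MulEquiv.symm_apply_apply]

theorem finite_cyclicWords : (cyclicWords A C).Finite :=
  (List.finite_length_eq _ (minLength A C)).subset fun _ => length_of_mem_cyclicWords

theorem ne_nil_of_mem_cyclicWords (hC : C ≠ ConjClasses.mk 1) {w : List (Fin p × Bool)}
    (hw : w ∈ cyclicWords A C) : w ≠ [] := by
  rintro rfl
  have := hw.2
  rw [← one_eq_mk, _root_.map_one, ConjClasses.mem_carrier_iff_mk_eq] at this
  exact hC this.symm

/-- Elements of a conjugacy class whose length exceeds the minimal one are conjugates of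
cyclically reduced words by reduced words, without cancellation. -/
theorem mem_carrier_and_wordLength_eq_iff {m : ℕ} {x : Γ} :
    (x ∈ C.carrier ∧ wordLength A x = minLength A C + 2 * (m + 1)) ↔
      ∃ w ∈ cyclicWords A C, ∃ b : Fin p × Bool, IsReduced ((b.1, !b.2) :: w ++ [b]) ∧
        ∃ v ∈ continuations m b,
          A.repr.symm (FreeGroup.mk (invRev (b :: v) ++ (w ++ (b :: v)))) = x := by
  constructor
  · rintro ⟨hx, hlen⟩
    have hw := reduceCyclically_mem_cyclicWords (A := A) hx
    have hdec := reduceCyclically.conj_conjugator_reduceCyclically (A.repr x).toWord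
    set w := reduceCyclically (A.repr x).toWord
    set g := reduceCyclically.conjugator (A.repr x).toWord
    have hl := congrArg List.length hdec
    change _ = wordLength A x at hl
    rw [hlen, List.length_append, List.length_append, invRev_length,
      length_of_mem_cyclicWords hw] at hl
    -- The excess length is shared equally by the conjugator and its inverse. As it is positive, the
    -- conjugator has a letter `b` next to `w`.
    have hg : (invRev g).length = m + 1 := by rw [invRev_length]; omega
    obtain ⟨b, v, hbv⟩ := List.exists_cons_of_length_eq_add_one hg
    have hg' : g = invRev (b :: v) := by rw [← hbv, invRev_invRev]
    have hred : IsReduced (invRev (b :: v) ++ (w ++ (b :: v))) := by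
      rw [← hg', ← hbv, ← List.append_assoc, hdec]
      exact isReduced_toWord
    refine ⟨w, hw, b, hred.infix ⟨invRev v, v, by simp [invRev]⟩, v,
      mem_continuations.2 ⟨hred.infix ⟨invRev (b :: v) ++ w, [], by simp⟩, ?_⟩, ?_⟩
    · rw [hbv] at hg
      simpa using hg
    · rw [← hg', ← hbv, ← List.append_assoc, hdec, mk_toWord, MulEquiv.symm_apply_apply]
  · rintro ⟨w, hw, b, hb, v, hv, rfl⟩
    obtain ⟨hv, hvl⟩ := mem_continuations.1 hv
    have hred := isReduced_conj_append hv hb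
    refine ⟨?_, ?_⟩
    · have := hw.2
      rw [ConjClasses.mem_carrier_iff_mk_eq] at this ⊢
      rw [← this, ConjClasses.mk_eq_mk_iff_isConj, isConj_iff]
      refine ⟨A.repr.symm (FreeGroup.mk (b :: v)), ?_⟩
      rw [← _root_.map_inv, ← _root_.map_mul, ← _root_.map_mul, ← mul_mk, ← mul_mk (L₁ := w), ← inv_mk]
      group
    · rw [wordLength, MulEquiv.apply_symm_apply, hred.norm_mk]
      simp only [List.length_append, invRev_length, List.length_cons, hvl,
        length_of_mem_cyclicWords hw]
      ring

theorem conj_word_injective {w w' v v' : List (Fin p × Bool)} (hw : w.length = w'.length)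
    (hv : v.length = v'.length) (h : invRev v ++ (w ++ v) = invRev v' ++ (w' ++ v')) :
    w = w' ∧ v = v' :=
  List.append_inj (List.append_inj h (by rw [invRev_length, invRev_length, hv])).2 hw

end ConjClasses

/-! ### Passage to the limit and conclusion. -/

/-- Used with `q = 1`, `a = 0` for spheres and `q = 2`, `a = k` for conjugacy classes. The index
shift accounts for the letter split off from the word averaged over; qm / (a + q(m + 1)) tends to 1.
-/
theorem tendsto_of_abs_sub_le {f g : ℕ → ℝ} {lam q a c : ℝ} (hq : 0 < q) (ha : 0 ≤ a)
    (hf : Tendsto (fun n => f n / n) atTop (𝓝 lam))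
    (hg : ∀ m : ℕ, |g (m + 1) - q / (a + q * (m + 1)) * f m| ≤ c / (a + q * (m + 1))) :
    Tendsto g atTop (𝓝 lam) := by
  rw [← tendsto_add_atTop_iff_nat 1]
  have hden : Tendsto (fun m : ℕ => a + q * ((m : ℝ) + 1)) atTop atTop :=
    tendsto_atTop_add_const_left _ _ <| Tendsto.const_mul_atTop hq <|
      tendsto_atTop_add_const_right _ _ tendsto_natCast_atTop_atTop
  have hzero (b : ℝ) : Tendsto (fun m : ℕ => b / (a + q * ((m : ℝ) + 1))) atTop (𝓝 0) :=
    hden.const_div_atTop b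
  have hmain : Tendsto (fun m : ℕ => q / (a + q * ((m : ℝ) + 1)) * f m) atTop (𝓝 lam) := by
    have h1 : Tendsto (fun m : ℕ => (1 - (a + q) / (a + q * ((m : ℝ) + 1))) * (f m / m)) atTop
        (𝓝 ((1 - 0) * lam)) := (tendsto_const_nhds.sub (hzero _)).mul hf
    rw [sub_zero, one_mul] at h1
    refine h1.congr' ?_
    filter_upwards [eventually_gt_atTop 0] with m hm
    have hm' : (0 : ℝ) < m := by exact_mod_cast hm
    have : 0 < a + q * ((m : ℝ) + 1) := by positivity
    field_simp
    ring
  have hdiff := squeeze_zero_norm (f := fun m : ℕ => g (m + 1) - q / (a + q * ((m : ℝ) + 1)) * f m) hg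
    (hzero c)
  simpa using hdiff.add hmain

theorem theorem1p1 {Γ : Type*} [Group Γ] {p : ℕ} (hp : 2 ≤ p) (A : FreeGroupBasis (Fin p) Γ)
    {X : Type*} [MetricSpace X] [MulAction Γ X] (hX : IsCATNegOne X)
    (hΓ : IsConvexCocompact Γ X) (o : X) :
    ∃ lam : ℝ, 0 < lam ∧
      Tendsto (fun n : ℕ => average {x : Γ | wordLength A x = n}
        (fun x => dist o (x • o) / (n : ℝ))) atTop (𝓝 lam) ∧
      ∀ C : ConjClasses Γ, C ≠ ConjClasses.mk 1 →
        Tendsto (fun m : ℕ =>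
          average {x : Γ | x ∈ C.carrier ∧ wordLength A x = minLength A C + 2 * m}
            (fun x => dist o (x • o) / ((minLength A C + 2 * m : ℕ) : ℝ))) atTop (𝓝 lam) := by
  classical
  have := hΓ.isometric
  obtain ⟨K, hK0, hlin, hadd⟩ := exists_displacement_bounds A hX hΓ o
  set D : FreeGroup (Fin p) → ℝ := fun y => dist o (A.repr.symm y • o) with hDdef
  have hD : IsCoarseLength D K :=
    { nonneg := fun _ => dist_nonneg
      inv := fun x => by simp only [hDdef, map_inv, dist_orbit_inv]
      mul_le := fun x y => by simpa only [hDdef, map_mul] using dist_orbit_mul_le o _ _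
      add_le := fun x y h => by
        simpa only [hDdef, map_mul] using hadd (A.repr.symm x) (A.repr.symm y)
          (by simpa [wordLength] using h)
      norm_le := fun x => by simpa [wordLength] using hlin (A.repr.symm x)
      const_nonneg := hK0 }
  have hcard : 2 ≤ Fintype.card (Fin p) := by simpa using hp
  obtain ⟨lam, f, B, hlam, hf, hB0, hB⟩ := hD.exists_growth hcard
  obtain ⟨M, hM0, hM⟩ := hD.exists_letter_bound
  refine ⟨lam, hlam, ?_, fun C hC => ?_⟩
  · refine tendsto_of_abs_sub_le (q := 1) (a := 0) (c := M + B) one_pos le_rfl hf fun m => ?_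
    have hm : (0 : ℝ) < 0 + 1 * ((m : ℝ) + 1) := by positivity
    refine abs_average_sub_le (I := Finset.univ) (l := id) (m := m)
      (φ := fun b w => A.repr.symm (FreeGroup.mk (b :: w)))
      (F := fun w => D (FreeGroup.mk w)) (K := B) (K' := M / (0 + 1 * ((m : ℝ) + 1)))
      ⟨(⟨0, by omega⟩, true), Finset.mem_univ _⟩ ?_ ?_ (by positivity) ?_ (fun i _ => hB m i)
      (le_of_eq (by ring))
    · intro x
      simp only [mem_ofPred_eq, Finset.mem_univ, true_and, id, mem_continuations]
      constructor
      · intro hx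
        obtain ⟨b, w, hbw⟩ := List.exists_cons_of_length_eq_add_one hx
        refine ⟨b, w, ⟨hbw ▸ FreeGroup.isReduced_toWord, ?_⟩, ?_⟩
        · have : (A.repr x).toWord.length = m + 1 := hx
          rw [hbw] at this
          simpa using this
        · rw [← hbw, FreeGroup.mk_toWord, MulEquiv.symm_apply_apply]
      · rintro ⟨b, w, ⟨hred, hlen⟩, rfl⟩
        rw [wordLength, MulEquiv.apply_symm_apply, hred.norm_mk, List.length_cons, hlen]
    · intro b _ w hw b' _ w' hw' h
      simp only [id] at hw hw'
      have h1 := congrArg FreeGroup.toWord (A.repr.symm.injective h)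
      rw [FreeGroup.toWord_mk, FreeGroup.toWord_mk, (mem_continuations.1 hw).1.reduce_eq,
        (mem_continuations.1 hw').1.reduce_eq] at h1
      exact List.cons.inj h1
    · intro b _ w _
      have : dist o (A.repr.symm (FreeGroup.mk (b :: w)) • o) / ((m + 1 : ℕ) : ℝ) -
          1 / (0 + 1 * ((m : ℝ) + 1)) * D (FreeGroup.mk w) =
          (D (FreeGroup.mk (b :: w)) - D (FreeGroup.mk w)) / (0 + 1 * ((m : ℝ) + 1)) := by
        push_cast
        simp only [hDdef]
        ring
      rw [this, abs_div, abs_of_pos hm]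
      gcongr
      exact hM b w
  · obtain ⟨x₀, hx₀⟩ := C.exists_rep
    have hfin := finite_cyclicWords (A := A) (C := C)
    set k := minLength A C with hk
    -- The pairs (w, b) for which b⁻¹wb is reduced; each contributes the words `v` that may follow
    -- `b`.
    set I : Finset (List (Fin p × Bool) × (Fin p × Bool)) :=
      (hfin.toFinset ×ˢ Finset.univ).filter
        fun i => FreeGroup.IsReduced ((i.2.1, !i.2.2) :: i.1 ++ [i.2]) with hI
    have hmemI (i) : i ∈ I ↔ i.1 ∈ cyclicWords A C ∧
        FreeGroup.IsReduced ((i.2.1, !i.2.2) :: i.1 ++ [i.2]) := by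
      simp [hI]
    have hIne : I.Nonempty := by
      have hw := reduceCyclically_mem_cyclicWords (A := A)
        (ConjClasses.mem_carrier_iff_mk_eq.2 hx₀)
      obtain ⟨b, hb⟩ := exists_letter_conj_isReduced hcard hw.1.isReduced
        (ne_nil_of_mem_cyclicWords hC hw)
      exact ⟨(_, b), (hmemI _).2 ⟨hw, hb⟩⟩
    obtain ⟨Q, hQ⟩ := (hfin.image fun w => D (FreeGroup.mk w)).bddAbove
    -- `Q + K` bounds the error of replacing the conjugate by twice the conjugator, `2 * M` that of
    -- dropping `b`, and `2 * B` that of replacing the average by `f m`.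
    refine tendsto_of_abs_sub_le (q := 2) (a := k) (c := Q + K + 2 * M + 2 * B) two_pos
      (Nat.cast_nonneg k) hf fun m => ?_
    have hm : (0 : ℝ) < k + 2 * ((m : ℝ) + 1) := by positivity
    refine abs_average_sub_le (I := I) (l := Prod.snd) (m := m)
      (φ := fun i v => A.repr.symm
        (FreeGroup.mk (FreeGroup.invRev (i.2 :: v) ++ (i.1 ++ (i.2 :: v)))))
      (F := fun w => D (FreeGroup.mk w)) (K := B)
      (K' := (Q + K + 2 * M) / (k + 2 * ((m : ℝ) + 1)))
      hIne ?_ ?_ (by positivity) ?_ (fun i _ => hB m i.2) (le_of_eq (by ring))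
    · intro x
      rw [mem_ofPred_eq, hk, mem_carrier_and_wordLength_eq_iff]
      constructor
      · rintro ⟨w, hw, b, hb, v, hv, h⟩
        exact ⟨(w, b), (hmemI _).2 ⟨hw, hb⟩, v, hv, h⟩
      · rintro ⟨⟨w, b⟩, hi, v, hv, h⟩
        exact ⟨w, ((hmemI _).1 hi).1, b, ((hmemI _).1 hi).2, v, hv, h⟩
    · rintro ⟨w, b⟩ hi v hv ⟨w', b'⟩ hi' v' hv' h
      obtain ⟨hw, hb⟩ := (hmemI _).1 hi
      obtain ⟨hw', hb'⟩ := (hmemI _).1 hi'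
      obtain ⟨hv, hvl⟩ := mem_continuations.1 hv
      obtain ⟨hv', hvl'⟩ := mem_continuations.1 hv'
      have h1 := congrArg FreeGroup.toWord (A.repr.symm.injective h)
      rw [FreeGroup.toWord_mk, FreeGroup.toWord_mk, (isReduced_conj_append hv hb).reduce_eq,
        (isReduced_conj_append hv' hb').reduce_eq] at h1
      obtain ⟨h2, h3⟩ := conj_word_injective
        ((length_of_mem_cyclicWords hw).trans (length_of_mem_cyclicWords hw').symm)
        (by rw [List.length_cons, List.length_cons, hvl, hvl']) h1
      obtain ⟨h4, h5⟩ := List.cons.inj h3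
      exact ⟨Prod.ext h2 h4, h5⟩
    · rintro ⟨w, b⟩ hi v hv
      obtain ⟨hw, hb⟩ := (hmemI _).1 hi
      have h1 := hD.abs_conj_sub_le (isReduced_conj_append (mem_continuations.1 hv).1 hb)
      have h2 : D (FreeGroup.mk w) ≤ Q := hQ ⟨w, hw, rfl⟩
      have h3 := abs_le.1 (hM b v)
      have h4 : |D (FreeGroup.mk (FreeGroup.invRev (b :: v) ++ (w ++ (b :: v)))) -
          2 * D (FreeGroup.mk v)| ≤ Q + K + 2 * M := by
        rw [abs_le] at h1 ⊢
        constructor <;> linarith [h1.1, h1.2, h3.1, h3.2]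
      have : dist o (A.repr.symm (FreeGroup.mk
          (FreeGroup.invRev (b :: v) ++ (w ++ (b :: v)))) • o) / ((k + 2 * (m + 1) : ℕ) : ℝ) -
          2 / (k + 2 * ((m : ℝ) + 1)) * D (FreeGroup.mk v) =
          (D (FreeGroup.mk (FreeGroup.invRev (b :: v) ++ (w ++ (b :: v)))) -
            2 * D (FreeGroup.mk v)) / (k + 2 * ((m : ℝ) + 1)) := by
        push_cast
        simp only [hDdef]
        ring
      rw [this, abs_div, abs_of_pos hm]
      gcongr
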